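/- Let $\mathfrak{S}$ be the Schrödinger algebra, the complex Lie algebra with basis $e,h,f,p,q,z$ and brackets $[h,e]=2e$, $[h,f]=-2f$, $[e,f]=h$, $[h,p]=p$, $[h,q]=-q$, $[p,q]=z$, $[e,q]=p$, $[p,f]=-q$, $[f,q]=0$, $[e,p]=0$, with $z$ central, and let $\mathcal{H}=\mathrm{span}_{\mathbb{C}}\{p,q,z\}$ be its Heisenberg subalgebra. Let $\phi:\mathcal{H}\to\mathbb{C}$ be a nonzero Lie algebra homomorphism, and let $\mathbb{C}_\phi=\mathbb{C}w$ be the one-dimensional $\mathcal{H}$-module with $xw=\phi(x)w$ for $x\in\mathcal{H}$. Let $$M_\phi=\mathcal{U}(\mathfrak{S})\otimes_{\mathcal{U}(\mathcal{H})}\mathbb{C}_\phi$$ be the universal quasi-Whittaker module of type $\phi$, and write $w$ also for its cyclic vector $1\otimes w$. Put $C=\phi(p)^2f-\phi(q)^2e-\phi(p)\phi(q)h\in\mathcal{U}(\mathfrak{S})$. A nonzero vector $v$ of an $\mathfrak{S}$-module is called a quasi-Whittaker vector of type $\phi$ if $xv=\phi(x)v$ for all $x\in\mathcal{H}$. **Theorem.**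 Let $U\subseteq M_\phi$ be a nonzero $\mathfrak{S}$-submodule. Then $U\cong M_\phi$ as $\mathfrak{S}$-modules. Furthermore, there is a polynomial $d(x)\in\mathbb{C}[x]$ such that $d(C)w$ is a quasi-Whittaker vector of type $\phi$ and $U=\mathcal{U}(\mathfrak{S})\,d(C)w$. -/

import Mathlib

open Polynomial TensorProduct

attribute [local instance 100] LieRing.ofAssociativeRing

/-- The underlying space of the Schrödinger algebra: an element `x` stands for
`x.e • e + x.h • h + x.f • f + x.p • p + x.q • q + x.z • z`. -/
@[ext]
structure Schrodinger where
  e : ℂ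
  h : ℂ
  f : ℂ
  p : ℂ
  q : ℂ
  z : ℂ

namespace Schrodinger

instance : Zero Schrodinger := ⟨⟨0, 0, 0, 0, 0, 0⟩⟩

instance : Add Schrodinger :=
  ⟨fun x y => ⟨x.e + y.e, x.h + y.h, x.f + y.f, x.p + y.p, x.q + y.q, x.z + y.z⟩⟩

instance : Neg Schrodinger := ⟨fun x => ⟨-x.e, -x.h, -x.f, -x.p, -x.q, -x.z⟩⟩

instance : SMul ℂ Schrodinger :=
  ⟨fun c x => ⟨c * x.e, c * x.h, c * x.f, c * x.p, c * x.q, c * x.z⟩⟩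

/-- The bilinear bracket with `[h,e] = 2e`, `[h,f] = -2f`, `[e,f] = h`, `[h,p] = p`, `[h,q] = -q`,
`[p,q] = z`, `[e,q] = p`, `[p,f] = -q`, `[f,q] = 0`, `[e,p] = 0` and `z` central. -/
instance : Bracket Schrodinger Schrodinger :=
  ⟨fun x y =>
    { e := 2 * (x.h * y.e - x.e * y.h)
      h := x.e * y.f - x.f * y.e
      f := -2 * (x.h * y.f - x.f * y.h)
      p := (x.h * y.p - x.p * y.h) + (x.e * y.q - x.q * y.e)
      q := -(x.h * y.q - x.q * y.h) - (x.p * y.f - x.f * y.p)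
      z := x.p * y.q - x.q * y.p }⟩

section projections

variable (x y : Schrodinger) (c : ℂ)

@[simp] theorem zero_e : (0 : Schrodinger).e = 0 := rfl
@[simp] theorem zero_h : (0 : Schrodinger).h = 0 := rfl
@[simp] theorem zero_f : (0 : Schrodinger).f = 0 := rfl
@[simp] theorem zero_p : (0 : Schrodinger).p = 0 := rfl
@[simp] theorem zero_q : (0 : Schrodinger).q = 0 := rfl
@[simp] theorem zero_z : (0 : Schrodinger).z = 0 := rfl

@[simp] theorem add_e : (x + y).e = x.e + y.e := rfl
@[simp] theorem add_h : (x + y).h = x.h + y.h := rfl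
@[simp] theorem add_f : (x + y).f = x.f + y.f := rfl
@[simp] theorem add_p : (x + y).p = x.p + y.p := rfl
@[simp] theorem add_q : (x + y).q = x.q + y.q := rfl
@[simp] theorem add_z : (x + y).z = x.z + y.z := rfl

@[simp] theorem neg_e : (-x).e = -x.e := rfl
@[simp] theorem neg_h : (-x).h = -x.h := rfl
@[simp] theorem neg_f : (-x).f = -x.f := rfl
@[simp] theorem neg_p : (-x).p = -x.p := rfl
@[simp] theorem neg_q : (-x).q = -x.q := rfl
@[simp] theorem neg_z : (-x).z = -x.z := rfl

@[simp] theorem smul_e : (c • x).e = c * x.e := rfl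
@[simp] theorem smul_h : (c • x).h = c * x.h := rfl
@[simp] theorem smul_f : (c • x).f = c * x.f := rfl
@[simp] theorem smul_p : (c • x).p = c * x.p := rfl
@[simp] theorem smul_q : (c • x).q = c * x.q := rfl
@[simp] theorem smul_z : (c • x).z = c * x.z := rfl

@[simp] theorem lie_e : ⁅x, y⁆.e = 2 * (x.h * y.e - x.e * y.h) := rfl
@[simp] theorem lie_h : ⁅x, y⁆.h = x.e * y.f - x.f * y.e := rfl
@[simp] theorem lie_f : ⁅x, y⁆.f = -2 * (x.h * y.f - x.f * y.h) := rfl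
@[simp] theorem lie_p :
    ⁅x, y⁆.p = (x.h * y.p - x.p * y.h) + (x.e * y.q - x.q * y.e) := rfl
@[simp] theorem lie_q :
    ⁅x, y⁆.q = -(x.h * y.q - x.q * y.h) - (x.p * y.f - x.f * y.p) := rfl
@[simp] theorem lie_z : ⁅x, y⁆.z = x.p * y.q - x.q * y.p := rfl

end projections

instance : AddCommGroup Schrodinger where
  add_assoc x y w := by ext <;> simp [add_assoc]
  zero_add x := by ext <;> simp
  add_zero x := by ext <;> simp
  add_comm x y := by ext <;> simp [add_comm]
  neg_add_cancel x := by ext <;> simp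
  nsmul := nsmulRec
  zsmul := zsmulRec

instance : Module ℂ Schrodinger where
  one_smul x := by ext <;> simp
  mul_smul a b x := by ext <;> simp [mul_assoc]
  smul_zero a := by ext <;> simp
  smul_add a x y := by ext <;> simp [mul_add]
  add_smul a b x := by ext <;> simp [add_mul]
  zero_smul x := by ext <;> simp

/-- The Schrödinger algebra is a Lie ring. -/
instance : LieRing Schrodinger where
  add_lie x y w := by ext <;> simp <;> ring
  lie_add x y w := by ext <;> simp <;> ring
  lie_self x := by ext <;> simp <;> ring
  leibniz_lie x y w := by ext <;> simp <;> ring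

/-- The Schrödinger algebra is a complex Lie algebra. -/
instance : LieAlgebra ℂ Schrodinger where
  lie_smul c x y := by ext <;> simp <;> ring

/-! The standard basis. -/

def E : Schrodinger := ⟨1, 0, 0, 0, 0, 0⟩
def H : Schrodinger := ⟨0, 1, 0, 0, 0, 0⟩
def F : Schrodinger := ⟨0, 0, 1, 0, 0, 0⟩
def P : Schrodinger := ⟨0, 0, 0, 1, 0, 0⟩
def Q : Schrodinger := ⟨0, 0, 0, 0, 1, 0⟩
def Z : Schrodinger := ⟨0, 0, 0, 0, 0, 1⟩

/-- The defining commutation relations. -/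
theorem bracket_relations :
    ⁅H, E⁆ = (2 : ℂ) • E ∧ ⁅H, F⁆ = (-2 : ℂ) • F ∧ ⁅E, F⁆ = H ∧
    ⁅H, P⁆ = P ∧ ⁅H, Q⁆ = -Q ∧ ⁅P, Q⁆ = Z ∧
    ⁅E, Q⁆ = P ∧ ⁅P, F⁆ = -Q ∧ ⁅F, Q⁆ = 0 ∧
    ⁅E, P⁆ = 0 ∧ ∀ x : Schrodinger, ⁅Z, x⁆ = 0 := by
  refine ⟨?_, ?_, ?_, ?_, ?_, ?_, ?_, ?_, ?_, ?_, fun x => ?_⟩ <;>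
    ext <;> simp [E, H, F, P, Q, Z]

theorem mem_span_PQZ {x : Schrodinger} :
    x ∈ Submodule.span ℂ {P, Q, Z} ↔ x.e = 0 ∧ x.h = 0 ∧ x.f = 0 := by
  rw [Submodule.mem_span_triple]
  constructor
  · rintro ⟨a, b, c, rfl⟩
    simp [P, Q, Z]
  · rintro ⟨he, hh, hf⟩
    refine ⟨x.p, x.q, x.z, ?_⟩
    ext <;> simp [P, Q, Z, he, hh, hf]

/-- The Heisenberg subalgebra `span {p, q, z}`. -/
def heisenberg : LieSubalgebra ℂ Schrodinger where
  toSubmodule := Submodule.span ℂ {P, Q, Z}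
  lie_mem' := by
    intro x y hx hy
    have hx' := mem_span_PQZ.1 hx
    have hy' := mem_span_PQZ.1 hy
    refine mem_span_PQZ.2 ?_
    simp [hx'.1, hx'.2.1, hx'.2.2, hy'.1, hy'.2.1, hy'.2.2]

/-- `p` as an element of the Heisenberg subalgebra. -/
def heisP : heisenberg := ⟨P, Submodule.subset_span (by simp)⟩

/-- `q` as an element of the Heisenberg subalgebra. -/
def heisQ : heisenberg := ⟨Q, Submodule.subset_span (by simp)⟩

end Schrodinger

/-! ### Induced modules over noncommutative algebras -/

section Induced

variable {k A B : Type*} [CommRing k] [Ring A] [Algebra k A] [Ring B] [Algebra k B]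

/-- The `A`-submodule of `A ⊗[k] N` generated by the relations `(a b) ⊗ n = a ⊗ (b n)` for `b` in
`B`, where `B` acts on `A` from the right through `g : B → A`. -/
def balancedRelations (g : B →ₐ[k] A) (N : Type*) [AddCommGroup N] [Module k N] [Module B N] :
    Submodule A (A ⊗[k] N) :=
  Submodule.span A
    {t | ∃ (a : A) (b : B) (n : N), t = (a * g b) ⊗ₜ[k] n - a ⊗ₜ[k] (b • n)}

/-- The left `A`-module `A ⊗_B N`, the tensor product over the (possibly noncommutative)
`k`-algebra `B`, where `A` is a right `B`-module through `g : B → A`. -/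
abbrev InducedModule (g : B →ₐ[k] A) (N : Type*) [AddCommGroup N] [Module k N] [Module B N] :
    Type _ :=
  (A ⊗[k] N) ⧸ balancedRelations g N

end Induced

/-! ### The universal quasi-Whittaker module -/

noncomputable section

namespace Schrodinger

/-- The universal enveloping algebra of the Schrödinger algebra. Modules over the Lie algebra
are regarded as modules over it. -/
abbrev USch : Type := UniversalEnvelopingAlgebra ℂ Schrodinger

/-- The universal enveloping algebra of the Heisenberg subalgebra. -/
abbrev UHeis : Type := UniversalEnvelopingAlgebra ℂ heisenberg

/-- The algebra map between the enveloping algebras induced by the inclusion of the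
Heisenberg subalgebra. -/
def heisToSch : UHeis →ₐ[ℂ] USch :=
  UniversalEnvelopingAlgebra.lift ℂ
    ((UniversalEnvelopingAlgebra.ι ℂ : Schrodinger →ₗ⁅ℂ⁆ USch).comp heisenberg.incl)

/-- The one-dimensional space underlying the module over the Heisenberg algebra on which `x`
acts as the scalar `φ x`. -/
def OneDim (_φ : heisenberg →ₗ⁅ℂ⁆ ℂ) : Type := ℂ

instance (φ : heisenberg →ₗ⁅ℂ⁆ ℂ) : AddCommGroup (OneDim φ) := inferInstanceAs (AddCommGroup ℂ)

instance (φ : heisenberg →ₗ⁅ℂ⁆ ℂ) : Module ℂ (OneDim φ) := inferInstanceAs (Module ℂ ℂ)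

/-- The action of the enveloping algebra of the Heisenberg algebra on the one-dimensional module
given by `φ`. -/
instance (φ : heisenberg →ₗ⁅ℂ⁆ ℂ) : Module UHeis (OneDim φ) :=
  Module.compHom ℂ (UniversalEnvelopingAlgebra.lift ℂ φ).toRingHom

/-- The universal quasi-Whittaker module of type `φ`: the module over the Schrödinger algebra
induced from the one-dimensional module `OneDim φ` over the Heisenberg subalgebra. -/
abbrev UniversalQW (φ : heisenberg →ₗ⁅ℂ⁆ ℂ) : Type :=
  InducedModule heisToSch (OneDim φ)

/-- The basis vector of the one-dimensional module. -/
def oneDimGen (φ : heisenberg →ₗ⁅ℂ⁆ ℂ) : OneDim φ := (1 : ℂ)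

/-- The canonical cyclic vector `w = 1 ⊗ w` of the universal quasi-Whittaker module. -/
def UniversalQW.gen (φ : heisenberg →ₗ⁅ℂ⁆ ℂ) : UniversalQW φ :=
  Submodule.Quotient.mk ((1 : USch) ⊗ₜ[ℂ] oneDimGen φ)

/-- A nonzero vector `v` of a module over the Schrödinger algebra is a quasi-Whittaker vector of
type `φ` if `x v = φ(x) v` for all `x` in the Heisenberg subalgebra. -/
def IsQuasiWhittakerVector (φ : heisenberg →ₗ⁅ℂ⁆ ℂ) {V : Type*} [AddCommGroup V] [Module USch V]
    (v : V) : Prop :=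
  v ≠ 0 ∧ ∀ x : heisenberg,
    UniversalEnvelopingAlgebra.ι ℂ (x : Schrodinger) • v = algebraMap ℂ USch (φ x) • v

/-- The element `C = φ(p)² f - φ(q)² e - φ(p) φ(q) h` of the enveloping algebra. -/
def elemC (φ : heisenberg →ₗ⁅ℂ⁆ ℂ) : USch :=
  UniversalEnvelopingAlgebra.ι ℂ
    (φ heisP ^ 2 • F - φ heisQ ^ 2 • E - (φ heisP * φ heisQ) • H : Schrodinger)

end Schrodinger

end

/-!
A character `φ` of the Heisenberg subalgebra kills `z = [p, q]`, so it is a nonzero vector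
`(φ(p), φ(q))` of the plane, on which the automorphism group `SL₂` of the Schrödinger algebra acts
transitively. One may therefore pass to the character with `p ↦ 1`, `q ↦ 0`, and then `C` becomes
`f` (`DualPair.twist`, `DualPair.twist_preF`).

For this character the module is described by its action on the ordered monomials
`e ^ i h ^ j f ^ k w`: on the polynomial ring `ℂ[t][h][e]`, with `σ : h ↦ h - 1` and `∂ = ∂/∂e`,
the elements act by `e = e·`, `h = h + 2e∂`, `f = tσ⁻² - h∂ - e∂²`, `p = σ`, `q = -∂σ`, `z = 0`.
These operators satisfy the relations (`PolyModel.rep`). The universal property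
(`UniversalQW.exists_lift`) gives a map from the universal module to this model; the ordered
monomials give a linear map back, which intertwines the actions (`DualPair.fromModel_rep`), and the
two are mutually inverse (`DualPair.exists_equiv_model`).
Under this isomorphism `d(C) w` corresponds
to `d(t)`; no Poincaré–Birkhoff–Witt theorem is needed.

In the model, `q` lowers the degree in `e` and `p - 1` lowers the degree in `h`, so a submodule
contains the coefficients, in `ℂ[t]`, of each of its elements; it is therefore generated by
the polynomials in `t` that it contains (`DualPair.le_of_const_mem`). These form an ideal of the
principal ideal domain `ℂ[t]`, generated by some `d` (`DualPair.exists_eq_span_const`), so that the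
submodule is generated by `d(C) w`. Multiplication by `d(t)` commutes with the action and is
injective if `d ≠ 0`, and it identifies the whole module with the submodule
(`DualPair.exists_injective_const`).
-/

namespace Schrodinger

noncomputable section

/-! ### Modules over the enveloping algebra -/

/-- The enveloping algebra is generated by the Lie algebra, in the form of an induction
principle for subalgebras. -/
theorem mem_of_forall_ι_mem {L : Type*} [LieRing L] [LieAlgebra ℂ L]
    (S : Subalgebra ℂ (UniversalEnvelopingAlgebra ℂ L))
    (hS : ∀ x : L, UniversalEnvelopingAlgebra.ι ℂ x ∈ S) (a : UniversalEnvelopingAlgebra ℂ L) :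
    a ∈ S := by
  let j : L →ₗ⁅ℂ⁆ S :=
    { toFun := fun x => ⟨UniversalEnvelopingAlgebra.ι ℂ x, hS x⟩
      map_add' := fun x y => Subtype.ext (by simp only [map_add]; rfl)
      map_smul' := fun c x => Subtype.ext (by simp only [map_smul]; rfl)
      map_lie' := fun {x y} => Subtype.ext (by simp only [LieHom.map_lie]; rfl) }
  have h : S.val.comp (UniversalEnvelopingAlgebra.lift ℂ j) = AlgHom.id ℂ _ := by
    apply UniversalEnvelopingAlgebra.hom_ext
    ext x
    change S.val (UniversalEnvelopingAlgebra.lift ℂ j (UniversalEnvelopingAlgebra.ι ℂ x)) =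
      UniversalEnvelopingAlgebra.ι ℂ x
    rw [UniversalEnvelopingAlgebra.lift_ι_apply]
    rfl
  have := DFunLike.congr_fun h a
  simp only [AlgHom.comp_apply, AlgHom.id_apply] at this
  rw [← this]
  exact (UniversalEnvelopingAlgebra.lift ℂ j a).2

theorem ι_mul_ι (x y : Schrodinger) :
    UniversalEnvelopingAlgebra.ι ℂ x * UniversalEnvelopingAlgebra.ι ℂ y =
      UniversalEnvelopingAlgebra.ι ℂ y * UniversalEnvelopingAlgebra.ι ℂ x +
        UniversalEnvelopingAlgebra.ι ℂ ⁅x, y⁆ := by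
  rw [LieHom.map_lie, LieRing.of_associative_ring_bracket]
  abel

theorem ι_smul_ι_smul {V : Type*} [AddCommGroup V] [Module USch V]
    (x y : Schrodinger) (m : V) :
    UniversalEnvelopingAlgebra.ι ℂ x • UniversalEnvelopingAlgebra.ι ℂ y • m =
      UniversalEnvelopingAlgebra.ι ℂ y • UniversalEnvelopingAlgebra.ι ℂ x • m +
        UniversalEnvelopingAlgebra.ι ℂ ⁅x, y⁆ • m := by
  rw [smul_smul, ι_mul_ι, add_smul, mul_smul]

/-- A `ℂ`-linear map commuting with the Lie algebra action is linear over the enveloping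
algebra. -/
def linearMapOfLie {V W : Type*} [AddCommGroup V] [Module ℂ V] [Module USch V]
    [IsScalarTower ℂ USch V] [AddCommGroup W] [Module ℂ W] [Module USch W]
    [IsScalarTower ℂ USch W] (T : V →ₗ[ℂ] W)
    (hT : ∀ (x : Schrodinger) (v : V), T (UniversalEnvelopingAlgebra.ι ℂ x • v) =
      UniversalEnvelopingAlgebra.ι ℂ x • T v) : V →ₗ[USch] W where
  toFun := T
  map_add' := T.map_add
  map_smul' a v := by
    let S : Subalgebra ℂ USch :=
      { carrier := {a | ∀ v, T (a • v) = a • T v}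
        mul_mem' := fun {a b} ha hb v => by
          rw [mul_smul, ha, hb, mul_smul]
        add_mem' := fun {a b} ha hb v => by
          rw [add_smul, map_add, ha, hb, add_smul]
        algebraMap_mem' := fun c v => by
          rw [algebraMap_smul, algebraMap_smul, map_smul] }
    exact mem_of_forall_ι_mem S hT a v

/-- The space `V` of a representation `ρ` of the Schrödinger algebra, regarded as a module over
the enveloping algebra. -/
def RepSpace {V : Type*} [AddCommGroup V] [Module ℂ V]
    (_ρ : Schrodinger →ₗ⁅ℂ⁆ Module.End ℂ V) : Type _ := V

section RepSpace

variable {V : Type*} [AddCommGroup V] [Module ℂ V] (ρ : Schrodinger →ₗ⁅ℂ⁆ Module.End ℂ V)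

instance : AddCommGroup (RepSpace ρ) := inferInstanceAs (AddCommGroup V)

instance : Module ℂ (RepSpace ρ) := inferInstanceAs (Module ℂ V)

instance : Module USch (RepSpace ρ) :=
  Module.compHom V (UniversalEnvelopingAlgebra.lift ℂ ρ).toRingHom

theorem repSpace_smul_def (a : USch) (v : RepSpace ρ) :
    a • v = (UniversalEnvelopingAlgebra.lift ℂ ρ a : Module.End ℂ V) v := rfl

theorem repSpace_ι_smul (x : Schrodinger) (v : RepSpace ρ) :
    UniversalEnvelopingAlgebra.ι ℂ x • v = (ρ x : Module.End ℂ V) v := by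
  rw [repSpace_smul_def, UniversalEnvelopingAlgebra.lift_ι_apply]

instance : IsScalarTower ℂ USch (RepSpace ρ) :=
  IsScalarTower.of_algebraMap_smul fun c v => by
    rw [repSpace_smul_def, AlgHom.commutes]
    rfl

end RepSpace

/-! ### The universal property of the universal quasi-Whittaker module -/

section universal

variable (φ : heisenberg →ₗ⁅ℂ⁆ ℂ)

/-- The coordinate of a vector of `OneDim φ` with respect to `oneDimGen φ`. -/
def oneDimCoord : OneDim φ ≃ₗ[ℂ] ℂ := LinearEquiv.refl ℂ ℂ

theorem oneDimCoord_gen : oneDimCoord φ (oneDimGen φ) = 1 := rfl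

theorem oneDimCoord_uHeis_smul (b : UHeis) (n : OneDim φ) :
    oneDimCoord φ (b • n) = UniversalEnvelopingAlgebra.lift ℂ φ b * oneDimCoord φ n := rfl

theorem UniversalQW.span_gen :
    Submodule.span USch {UniversalQW.gen φ} = (⊤ : Submodule USch (UniversalQW φ)) := by
  rw [eq_top_iff]
  rintro m -
  obtain ⟨t, rfl⟩ := Submodule.Quotient.mk_surjective _ m
  induction t with
  | zero => exact Submodule.zero_mem _
  | add s t hs ht => exact Submodule.add_mem _ hs ht
  | tmul a n =>
    refine Submodule.mem_span_singleton.2 ⟨oneDimCoord φ n • a, ?_⟩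
    rw [UniversalQW.gen, ← Submodule.Quotient.mk_smul, TensorProduct.smul_tmul', smul_eq_mul,
      mul_one, TensorProduct.smul_tmul]
    congr 2
    exact mul_one (oneDimCoord φ n)

/-- The generator transforms under the Heisenberg subalgebra by `φ`. -/
theorem UniversalQW.ι_smul_gen (x : heisenberg) :
    UniversalEnvelopingAlgebra.ι ℂ (x : Schrodinger) • UniversalQW.gen φ =
      φ x • UniversalQW.gen φ := by
  have h1 : heisToSch (UniversalEnvelopingAlgebra.ι ℂ x) =
      UniversalEnvelopingAlgebra.ι ℂ (x : Schrodinger) := by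
    rw [heisToSch, UniversalEnvelopingAlgebra.lift_ι_apply]
    rfl
  have h2 : (UniversalEnvelopingAlgebra.ι ℂ x : UHeis) • oneDimGen φ = φ x • oneDimGen φ := by
    change (UniversalEnvelopingAlgebra.lift ℂ φ (UniversalEnvelopingAlgebra.ι ℂ x)) • (1 : ℂ) = _
    rw [UniversalEnvelopingAlgebra.lift_ι_apply]
    rfl
  rw [UniversalQW.gen, ← Submodule.Quotient.mk_smul, ← Submodule.Quotient.mk_smul,
    TensorProduct.smul_tmul', ← TensorProduct.tmul_smul, ← h2, Submodule.Quotient.eq]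
  refine Submodule.subset_span ⟨1, UniversalEnvelopingAlgebra.ι ℂ x, oneDimGen φ, ?_⟩
  rw [h1, one_mul, smul_eq_mul, mul_one]

variable {φ} {V : Type*} [AddCommGroup V] [Module ℂ V] [Module USch V] [IsScalarTower ℂ USch V]

theorem uHeis_smul (v : V)
    (hv : ∀ x : heisenberg, UniversalEnvelopingAlgebra.ι ℂ (x : Schrodinger) • v = φ x • v)
    (b : UHeis) : heisToSch b • v = UniversalEnvelopingAlgebra.lift ℂ φ b • v := by
  let S : Subalgebra ℂ UHeis :=
    { carrier := {b | heisToSch b • v = UniversalEnvelopingAlgebra.lift ℂ φ b • v}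
      mul_mem' := fun {a b} ha hb => by
        rw [Set.mem_ofPred_eq] at ha hb ⊢
        rw [map_mul, mul_smul, hb, smul_comm, ha, map_mul, smul_smul, mul_comm]
      add_mem' := fun {a b} ha hb => by
        rw [Set.mem_ofPred_eq] at ha hb ⊢
        rw [map_add, add_smul, ha, hb, map_add, add_smul]
      algebraMap_mem' := fun c => by
        rw [Set.mem_ofPred_eq, AlgHom.commutes, AlgHom.commutes, algebraMap_smul, algebraMap_smul] }
  refine mem_of_forall_ι_mem S (fun x => ?_) b
  change heisToSch _ • v = UniversalEnvelopingAlgebra.lift ℂ φ _ • v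
  rw [heisToSch, UniversalEnvelopingAlgebra.lift_ι_apply, UniversalEnvelopingAlgebra.lift_ι_apply]
  exact hv x

/-- Vectors on which the Heisenberg subalgebra acts by `φ` are the images of the generator under
module homomorphisms. -/
theorem UniversalQW.exists_lift (v : V)
    (hv : ∀ x : heisenberg, UniversalEnvelopingAlgebra.ι ℂ (x : Schrodinger) • v = φ x • v) :
    ∃ T : UniversalQW φ →ₗ[USch] V, T (UniversalQW.gen φ) = v := by
  let T0 : USch ⊗[ℂ] OneDim φ →ₗ[USch] V :=
    TensorProduct.AlgebraTensorModule.lift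
      { toFun := fun a => (oneDimCoord φ).toLinearMap.smulRight (a • v)
        map_add' := fun a b => LinearMap.ext fun n => by simp [add_smul]
        map_smul' := fun a b => LinearMap.ext fun n => by
          simp [mul_smul, smul_comm a (oneDimCoord φ n)] }
  have hT0 : ∀ (a : USch) (n : OneDim φ), T0 (a ⊗ₜ n) = oneDimCoord φ n • (a • v) :=
    fun a n => rfl
  refine ⟨(balancedRelations heisToSch (OneDim φ)).liftQ T0 ?_, ?_⟩
  · rw [balancedRelations, Submodule.span_le]
    rintro _ ⟨a, b, n, rfl⟩
    rw [SetLike.mem_coe, LinearMap.mem_ker, map_sub, hT0, hT0, oneDimCoord_uHeis_smul, mul_smul a,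
      uHeis_smul v hv, smul_comm a, smul_smul, mul_comm, sub_self]
  · rw [UniversalQW.gen, Submodule.liftQ_apply, hT0, oneDimCoord_gen, one_smul, one_smul]

end universal

-- Instances on linear maps between iterated polynomial rings need nested instance searches.
set_option maxSynthPendingDepth 3

/-! ### A polynomial model -/

/-- The polynomial ring `ℂ[t][h][e]`: the outermost variable is `e`, the innermost one `t`. -/
abbrev PolyModel : Type := ℂ[X][X][X]

namespace PolyModel

/-- The substitution `h ↦ h + r` in the polynomial ring `ℂ[t][h][e]`. -/
def shift (r : ℂ[X]) : PolyModel →ₐ[ℂ] PolyModel :=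
  mapAlgHom ((taylorAlgHom r).restrictScalars ℂ)

/-- The derivation `∂/∂e` of `ℂ[t][h][e]`. -/
def del : Module.End ℂ PolyModel := (derivative (R := ℂ[X][X])).restrictScalars ℂ

theorem shift_C (r : ℂ[X]) (g : ℂ[X][X]) : shift r (C g) = C (taylor r g) := by
  simp [shift]

theorem shift_X (r : ℂ[X]) : shift r X = X := by
  simp [shift]

theorem coeff_shift (r : ℂ[X]) (u : PolyModel) (n : ℕ) :
    (shift r u).coeff n = taylor r (u.coeff n) := by
  simp [shift]

theorem shift_shift (r s : ℂ[X]) (u : PolyModel) : shift r (shift s u) = shift (r + s) u := by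
  ext1 n
  rw [coeff_shift, coeff_shift, coeff_shift, taylor_taylor]

theorem derivative_shift (r : ℂ[X]) (u : PolyModel) :
    derivative (shift r u) = shift r (derivative u) := by
  simp [shift, derivative_map]

/-- The action of `e`: multiplication by the variable `e`. -/
def opE : Module.End ℂ PolyModel := LinearMap.mulLeft ℂ X

/-- The action of `h`: the operator `h + 2 e ∂/∂e`. -/
def opH : Module.End ℂ PolyModel :=
  LinearMap.mulLeft ℂ (C X) + LinearMap.mulLeft ℂ (2 * X) ∘ₗ del

/-- The action of `f`: the operator `t σ⁻² - h ∂/∂e - e (∂/∂e)²`, where `σ` is `h ↦ h - 1`. -/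
def opF : Module.End ℂ PolyModel :=
  LinearMap.mulLeft ℂ (C (C X)) ∘ₗ (shift 2).toLinearMap - LinearMap.mulLeft ℂ (C X) ∘ₗ del -
    LinearMap.mulLeft ℂ X ∘ₗ del ∘ₗ del

/-- The action of `p`: the substitution `σ : h ↦ h - 1`. -/
def opP : Module.End ℂ PolyModel := (shift (-1)).toLinearMap

/-- The action of `q`: the operator `-(∂/∂e) σ`, where `σ` is `h ↦ h - 1`. -/
def opQ : Module.End ℂ PolyModel := -(del ∘ₗ (shift (-1)).toLinearMap)

theorem opE_apply (u : PolyModel) : opE u = X * u := rfl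

theorem opH_apply (u : PolyModel) : opH u = C X * u + 2 * X * derivative u := rfl

theorem opF_apply (u : PolyModel) :
    opF u = C (C X) * shift 2 u - C X * derivative u - X * derivative (derivative u) := rfl

theorem opP_apply (u : PolyModel) : opP u = shift (-1) u := rfl

theorem opQ_apply (u : PolyModel) : opQ u = -derivative (shift (-1) u) := rfl

theorem lie_opH_opE : ⁅opH, opE⁆ = (2 : ℂ) • opE := by
  refine LinearMap.ext fun u => ?_
  simp only [LieRing.of_associative_ring_bracket, LinearMap.sub_apply, Module.End.mul_apply,
    opH_apply, opE_apply, derivative_mul, derivative_X, LinearMap.smul_apply]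
  rw [two_smul]
  ring

theorem lie_opH_opF : ⁅opH, opF⁆ = (-2 : ℂ) • opF := by
  refine LinearMap.ext fun u => ?_
  rw [LinearMap.smul_apply, neg_smul, two_smul]
  simp only [LieRing.of_associative_ring_bracket, LinearMap.sub_apply, Module.End.mul_apply,
    opH_apply, opF_apply, derivative_mul, derivative_X, map_add, map_mul, map_sub, shift_C, shift_X,
    derivative_C, derivative_one, derivative_zero, taylor_X, derivative_shift, derivative_ofNat,
    map_ofNat]
  ring

theorem lie_opE_opF : ⁅opE, opF⁆ = opH := by
  refine LinearMap.ext fun u => ?_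
  simp only [LieRing.of_associative_ring_bracket, LinearMap.sub_apply, Module.End.mul_apply,
    opH_apply, opF_apply, opE_apply, derivative_mul, derivative_X, map_add, map_mul, map_sub,
    shift_X, derivative_one]
  ring

theorem lie_opH_opP : ⁅opH, opP⁆ = opP := by
  refine LinearMap.ext fun u => ?_
  simp only [LieRing.of_associative_ring_bracket, LinearMap.sub_apply, Module.End.mul_apply,
    opH_apply, opP_apply, map_add, map_mul, shift_X, shift_C, taylor_X, derivative_shift,
    map_ofNat, map_neg, map_one]
  ring

theorem lie_opH_opQ : ⁅opH, opQ⁆ = -opQ := by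
  refine LinearMap.ext fun u => ?_
  simp only [LieRing.of_associative_ring_bracket, LinearMap.sub_apply, Module.End.mul_apply,
    LinearMap.neg_apply,
    opH_apply, opQ_apply, derivative_mul, derivative_X, map_add, map_mul, derivative_C,
    shift_X, shift_C, derivative_one, taylor_X, derivative_shift, map_ofNat, map_neg, map_one,
    derivative_ofNat]
  ring

theorem lie_opP_opQ : ⁅opP, opQ⁆ = 0 := by
  refine LinearMap.ext fun u => ?_
  simp only [LieRing.of_associative_ring_bracket, LinearMap.sub_apply, Module.End.mul_apply,
    opP_apply, opQ_apply, derivative_shift, map_neg, sub_self, LinearMap.zero_apply]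

theorem lie_opE_opQ : ⁅opE, opQ⁆ = opP := by
  refine LinearMap.ext fun u => ?_
  simp only [LieRing.of_associative_ring_bracket, LinearMap.sub_apply, Module.End.mul_apply,
    opE_apply, opP_apply, opQ_apply, derivative_shift, map_neg, map_mul, shift_X, derivative_mul,
    derivative_X]
  ring

theorem lie_opP_opF : ⁅opP, opF⁆ = -opQ := by
  refine LinearMap.ext fun u => ?_
  simp only [LieRing.of_associative_ring_bracket, LinearMap.sub_apply, Module.End.mul_apply,
    LinearMap.neg_apply, opF_apply, opP_apply, opQ_apply, derivative_shift, map_neg, map_mul,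
    shift_X, shift_C, map_sub, taylor_X, taylor_C, map_one, shift_shift, map_add]
  rw [add_comm (-1 : ℂ[X]) 2]
  ring

theorem lie_opF_opQ : ⁅opF, opQ⁆ = 0 := by
  refine LinearMap.ext fun u => ?_
  simp only [LieRing.of_associative_ring_bracket, LinearMap.sub_apply, Module.End.mul_apply,
    LinearMap.zero_apply, opF_apply, opQ_apply, derivative_shift, map_neg, map_mul, derivative_X,
    derivative_mul, derivative_C, derivative_one,
    shift_X, shift_C, map_sub, taylor_X, taylor_C, map_one, shift_shift, map_add]
  rw [add_comm (-1 : ℂ[X]) 2]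
  ring

theorem lie_opE_opP : ⁅opE, opP⁆ = 0 := by
  refine LinearMap.ext fun u => ?_
  simp only [LieRing.of_associative_ring_bracket, LinearMap.sub_apply, Module.End.mul_apply,
    LinearMap.zero_apply, opE_apply, opP_apply, map_mul, shift_X, sub_self]

/-- The bracket of endomorphisms is bilinear over `ℂ`. -/
theorem lie_smul_smul (a b : ℂ) (S T : Module.End ℂ PolyModel) :
    ⁅a • S, b • T⁆ = (a * b) • ⁅S, T⁆ := by
  refine LinearMap.ext fun u => ?_
  simp only [LieRing.of_associative_ring_bracket, LinearMap.sub_apply, Module.End.mul_apply,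
    LinearMap.smul_apply, map_smul, smul_sub, mul_smul]
  rw [smul_comm b a]

/-- The representation of the Schrödinger algebra on `ℂ[t][h][e]` in which `p` fixes and `q`
annihilates the constant polynomial `1`. -/
def rep : Schrodinger →ₗ⁅ℂ⁆ Module.End ℂ PolyModel where
  toFun x := x.e • opE + x.h • opH + x.f • opF + x.p • opP + x.q • opQ
  map_add' x y := by simp only [add_e, add_h, add_f, add_p, add_q]; module
  map_smul' c x := by simp only [smul_e, smul_h, smul_f, smul_p, smul_q, RingHom.id_apply]; module
  map_lie' {x y} := by
    have hEH := lie_skew opE opH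
    have hFH := lie_skew opF opH
    have hFE := lie_skew opF opE
    have hPH := lie_skew opP opH
    have hQH := lie_skew opQ opH
    have hQP := lie_skew opQ opP
    have hQE := lie_skew opQ opE
    have hFP := lie_skew opF opP
    have hQF := lie_skew opQ opF
    have hPE := lie_skew opP opE
    rw [lie_opH_opE] at hEH
    rw [lie_opH_opF] at hFH
    rw [lie_opE_opF] at hFE
    rw [lie_opH_opP] at hPH
    rw [lie_opH_opQ] at hQH
    rw [lie_opP_opQ] at hQP
    rw [lie_opE_opQ] at hQE
    rw [lie_opP_opF] at hFP
    rw [lie_opF_opQ] at hQF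
    rw [lie_opE_opP] at hPE
    simp only [add_lie, lie_add, lie_smul_smul, lie_self, lie_opH_opE, lie_opH_opF,
      lie_opE_opF, lie_opH_opP, lie_opH_opQ, lie_opP_opQ, lie_opE_opQ, lie_opP_opF, lie_opF_opQ,
      lie_opE_opP, ← hEH, ← hFH, ← hFE, ← hPH, ← hQH, ← hQP, ← hQE, ← hFP, ← hQF, ← hPE, lie_e,
      lie_h, lie_f, lie_p, lie_q]
    module

end PolyModel

/-! ### Reduction to the character with `p ↦ 1`, `q ↦ 0` -/

theorem mem_heisenberg {x : Schrodinger} :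
    x ∈ heisenberg ↔ x.e = 0 ∧ x.h = 0 ∧ x.f = 0 :=
  mem_span_PQZ

/-- A character of the Heisenberg subalgebra kills `z = [p, q]`. -/
theorem character_apply (φ : heisenberg →ₗ⁅ℂ⁆ ℂ) (x : heisenberg) :
    φ x = (x : Schrodinger).p * φ heisP + (x : Schrodinger).q * φ heisQ := by
  have hx := mem_heisenberg.1 x.2
  have h : x = (x : Schrodinger).p • heisP + (x : Schrodinger).q • heisQ +
      (x : Schrodinger).z • ⁅heisP, heisQ⁆ := by
    apply Subtype.ext
    ext <;> simp [heisP, heisQ, P, Q, hx.1, hx.2.1, hx.2.2]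
  have h0 : φ ⁅heisP, heisQ⁆ = 0 := by
    rw [LieHom.map_lie, LieRing.of_associative_ring_bracket, mul_comm, sub_self]
  conv_lhs => rw [h]
  rw [map_add, map_add, map_smul, map_smul, map_smul, h0, smul_zero, add_zero, smul_eq_mul,
    smul_eq_mul]

/-- Coefficients `α, β` with `φ (α p + β q) = 1`. They single out the element of `SL₂` that
transforms `φ` into the character with `p ↦ 1` and `q ↦ 0`. -/
structure DualPair (φ : heisenberg →ₗ⁅ℂ⁆ ℂ) where
  α : ℂ
  β : ℂ
  eq_one : α * φ heisP + β * φ heisQ = 1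

theorem nonempty_dualPair {φ : heisenberg →ₗ⁅ℂ⁆ ℂ} (hφ : φ ≠ 0) : Nonempty (DualPair φ) := by
  by_cases hp : φ heisP = 0
  · by_cases hq : φ heisQ = 0
    · refine absurd (LieHom.ext fun x => ?_) hφ
      rw [character_apply, hp, hq, mul_zero, mul_zero, add_zero, LieHom.zero_apply]
    · exact ⟨⟨0, (φ heisQ)⁻¹, by rw [inv_mul_cancel₀ hq, zero_mul, zero_add]⟩⟩
  · exact ⟨⟨(φ heisP)⁻¹, 0, by rw [inv_mul_cancel₀ hp, zero_mul, add_zero]⟩⟩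

namespace DualPair

variable {φ : heisenberg →ₗ⁅ℂ⁆ ℂ} (D : DualPair φ)

/-- The automorphism of the Schrödinger algebra given by the matrix in `SL₂` sending
`α p + β q` to `p` and `φ(p) q - φ(q) p` to `q`. -/
def twist : Schrodinger →ₗ⁅ℂ⁆ Schrodinger where
  toFun x :=
    { e := φ heisP ^ 2 * x.e - 2 * φ heisP * φ heisQ * x.h - φ heisQ ^ 2 * x.f
      h := φ heisP * D.β * x.e + (D.α * φ heisP - D.β * φ heisQ) * x.h + D.α * φ heisQ * x.f
      f := -D.β ^ 2 * x.e - 2 * D.α * D.β * x.h + D.α ^ 2 * x.f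
      p := φ heisP * x.p + φ heisQ * x.q
      q := -D.β * x.p + D.α * x.q
      z := x.z }
  map_add' x y := by ext <;> simp <;> ring
  map_smul' c x := by ext <;> simp <;> ring
  map_lie' {x y} := by
    have h := D.eq_one
    -- Each coordinate of the twisted bracket, multiplied by the determinant
    -- `α φ(p) + β φ(q) = 1`, is the coordinate of the bracket of the twists.
    ext
    · simp only [lie_e, lie_h, lie_f]
      linear_combination (-2) * (φ heisP ^ 2 * (x.h * y.e - x.e * y.h) -
        φ heisP * φ heisQ * (x.e * y.f - x.f * y.e) + φ heisQ ^ 2 * (x.h * y.f - x.f * y.h)) * h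
    · simp only [lie_e, lie_h, lie_f]
      linear_combination (-(φ heisP * D.β * (2 * (x.h * y.e - x.e * y.h)) +
        (D.α * φ heisP - D.β * φ heisQ) * (x.e * y.f - x.f * y.e) +
        D.α * φ heisQ * (-2 * (x.h * y.f - x.f * y.h)))) * h
    · simp only [lie_e, lie_h, lie_f]
      linear_combination (-(-D.β ^ 2 * (2 * (x.h * y.e - x.e * y.h)) -
        2 * D.α * D.β * (x.e * y.f - x.f * y.e) +
        D.α ^ 2 * (-2 * (x.h * y.f - x.f * y.h)))) * h
    · simp only [lie_p, lie_q]
      linear_combination (-(φ heisP * ((x.h * y.p - x.p * y.h) + (x.e * y.q - x.q * y.e)) +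
        φ heisQ * (-(x.h * y.q - x.q * y.h) - (x.p * y.f - x.f * y.p)))) * h
    · simp only [lie_p, lie_q]
      linear_combination (-(-D.β * ((x.h * y.p - x.p * y.h) + (x.e * y.q - x.q * y.e)) +
        D.α * (-(x.h * y.q - x.q * y.h) - (x.p * y.f - x.f * y.p)))) * h
    · simp only [lie_z]
      linear_combination (-(x.p * y.q - x.q * y.p)) * h

/-- The preimage of `e` under the twist. -/
def preE : Schrodinger := ⟨D.α ^ 2, -(D.α * D.β), -D.β ^ 2, 0, 0, 0⟩

/-- The preimage of `h` under the twist. -/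
def preH : Schrodinger :=
  ⟨2 * D.α * φ heisQ, D.α * φ heisP - D.β * φ heisQ, 2 * D.β * φ heisP, 0, 0, 0⟩

/-- The preimage of `p` under the twist. -/
def preP : Schrodinger := ⟨0, 0, 0, D.α, D.β, 0⟩

/-- The preimage of `q` under the twist. -/
def preQ (_D : DualPair φ) : Schrodinger := ⟨0, 0, 0, -φ heisQ, φ heisP, 0⟩

/-- The element `φ(p)² f - φ(q)² e - φ(p) φ(q) h` of the Lie algebra, which is the preimage of `f`
under the twist. -/
def preF (_D : DualPair φ) : Schrodinger :=
  ⟨-φ heisQ ^ 2, -(φ heisP * φ heisQ), φ heisP ^ 2, 0, 0, 0⟩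

theorem elemC_eq : elemC φ = UniversalEnvelopingAlgebra.ι ℂ D.preF := by
  rw [elemC]
  congr 1
  rw [sub_eq_add_neg, sub_eq_add_neg]
  ext <;> simp [preF, E, F, H]

theorem twist_preE : D.twist D.preE = E := by
  have h := D.eq_one
  ext <;> simp only [twist, preE, E, LieHom.coe_mk]
  · linear_combination (D.α * φ heisP + D.β * φ heisQ + 1) * h
  all_goals ring

theorem twist_preH : D.twist D.preH = H := by
  have h := D.eq_one
  ext <;> simp only [twist, preH, H, LieHom.coe_mk]
  · ring
  · linear_combination (D.α * φ heisP + D.β * φ heisQ + 1) * h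
  all_goals ring

theorem twist_preF : D.twist D.preF = F := by
  have h := D.eq_one
  ext <;> simp only [twist, preF, F, LieHom.coe_mk]
  · ring
  · ring
  · linear_combination (D.α * φ heisP + D.β * φ heisQ + 1) * h
  all_goals ring

theorem twist_preP : D.twist D.preP = P := by
  have h := D.eq_one
  ext <;> simp only [twist, preP, P, LieHom.coe_mk]
  · ring
  · ring
  · ring
  · linear_combination h
  all_goals ring

theorem twist_preQ : D.twist D.preQ = Q := by
  have h := D.eq_one
  ext <;> simp only [twist, preQ, Q, LieHom.coe_mk]
  · ring
  · ring
  · ring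
  · ring
  · linear_combination h

theorem eq_pre_add (x : Schrodinger) :
    x = (D.twist x).e • D.preE + (D.twist x).h • D.preH + (D.twist x).f • D.preF +
      ⟨0, 0, 0, x.p, x.q, x.z⟩ := by
  have h := D.eq_one
  ext <;> simp only [twist, preE, preF, preH, LieHom.coe_mk, add_e, add_h, add_f, add_p, add_q,
    add_z, smul_e, smul_h, smul_f, smul_p, smul_q, smul_z]
  · linear_combination (-(D.α * φ heisP + D.β * φ heisQ + 1) * x.e) * h
  · linear_combination (-(D.α * φ heisP + D.β * φ heisQ + 1) * x.h) * h
  · linear_combination (-(D.α * φ heisP + D.β * φ heisQ + 1) * x.f) * h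
  all_goals ring

theorem twist_p (x : Schrodinger) : (D.twist x).p = x.p * φ heisP + x.q * φ heisQ := by
  change φ heisP * x.p + φ heisQ * x.q = _
  ring

theorem twist_heisenberg (x : heisenberg) :
    (D.twist x).e = 0 ∧ (D.twist x).h = 0 ∧ (D.twist x).f = 0 ∧ (D.twist x).p = φ x := by
  have hx := mem_heisenberg.1 x.2
  refine ⟨?_, ?_, ?_, ?_⟩
  · simp [twist, hx.1, hx.2.1, hx.2.2]
  · simp [twist, hx.1, hx.2.1, hx.2.2]
  · simp [twist, hx.1, hx.2.1, hx.2.2]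
  · rw [twist_p, character_apply φ x]

/-- Bracketing with `C` maps the Heisenberg subalgebra into the kernel of `φ`. -/
theorem lie_preF_mem (x : heisenberg) :
    ∃ y : heisenberg, (y : Schrodinger) = ⁅(x : Schrodinger), D.preF⁆ ∧ φ y = 0 := by
  have hx := mem_heisenberg.1 x.2
  refine ⟨⟨⁅(x : Schrodinger), D.preF⁆, mem_heisenberg.2 ?_⟩, rfl, ?_⟩
  · simp [hx.1, hx.2.1, hx.2.2]
  · rw [character_apply]
    simp only [lie_p, lie_q, preF, hx.1, hx.2.1, hx.2.2]
    ring

end DualPair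

/-! ### The model as a quasi-Whittaker module -/

namespace PolyModel

theorem rep_apply (x : Schrodinger) (u : PolyModel) :
    rep x u = x.e • opE u + x.h • opH u + x.f • opF u + x.p • opP u + x.q • opQ u := rfl

theorem opH_C (g : ℂ[X][X]) : opH (C g) = C (X * g) := by
  rw [opH_apply, derivative_C, mul_zero, add_zero, C_mul]

theorem opF_C (g : ℂ[X][X]) : opF (C g) = C (C X * taylor 2 g) := by
  rw [opF_apply, shift_C, derivative_C, derivative_zero, mul_zero, mul_zero, sub_zero, sub_zero,
    C_mul]

theorem opP_C (g : ℂ[X][X]) : opP (C g) = C (taylor (-1) g) := by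
  rw [opP_apply, shift_C]

theorem opQ_C (g : ℂ[X][X]) : opQ (C g) = 0 := by
  rw [opQ_apply, shift_C, derivative_C, neg_zero]

theorem exists_rep_C {x : Schrodinger} (hx : x.e = 0) (g : ℂ[X][X]) :
    ∃ g', rep x (C g) = C g' := by
  refine ⟨x.h • (X * g) + x.f • (C X * taylor 2 g) + x.p • taylor (-1) g, ?_⟩
  rw [rep_apply, opH_C, opF_C, opP_C, opQ_C, hx, zero_smul, zero_add, smul_zero, add_zero,
    smul_C, smul_C, smul_C, C_add, C_add]

theorem rep_C_C {x : Schrodinger} (hx : x.e = 0) (d : ℂ[X]) :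
    rep x (C (C d)) = x.h • C (X * C d) + x.f • C (C (X * d)) + x.p • C (C d) := by
  rw [rep_apply, opH_C, opF_C, opP_C, opQ_C, hx, zero_smul, zero_add, smul_zero, add_zero,
    taylor_C, taylor_C, C_mul (a := X) (b := d)]

theorem rep_E (u : PolyModel) : rep E u = X * u := by
  simp [rep_apply, E, opE_apply]

theorem rep_H (u : PolyModel) : rep H u = opH u := by
  simp [rep_apply, H]

theorem rep_F (u : PolyModel) : rep F u = opF u := by
  simp [rep_apply, F]

theorem rep_P (u : PolyModel) : rep P u = opP u := by
  simp [rep_apply, P]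

theorem rep_Q (u : PolyModel) : rep Q u = opQ u := by
  simp [rep_apply, Q]

theorem rep_rep (x y : Schrodinger) (u : PolyModel) :
    rep x (rep y u) = rep y (rep x u) + rep ⁅x, y⁆ u := by
  rw [LieHom.map_lie, LieRing.of_associative_ring_bracket, LinearMap.sub_apply,
    Module.End.mul_apply, Module.End.mul_apply]
  abel

end PolyModel

/-! ### The universal quasi-Whittaker module is isomorphic to the model -/

theorem polynomial_induction_X_mul {A : Type*} [CommRing A] {p : A[X] → Prop}
    (hC : ∀ a, p (C a)) (hadd : ∀ f g, p f → p g → p (f + g)) (hX : ∀ f, p f → p (X * f))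
    (f : A[X]) : p f := by
  refine Polynomial.induction_on f hC hadd fun n a h => ?_
  have : C a * X ^ (n + 1) = X * (C a * X ^ n) := by ring
  rw [this]
  exact hX _ h

/-- The extension of a linear map `f : A → V` to `A[X]` for which multiplication by `X` becomes
the operator `T`. -/
def polyLift {A V : Type*} [CommRing A] [Algebra ℂ A] [AddCommGroup V] [Module ℂ V]
    (T : Module.End ℂ V) (f : A →ₗ[ℂ] V) : A[X] →ₗ[ℂ] V :=
  lsum fun i => (T ^ i) ∘ₗ f

section polyLift

variable {A V : Type*} [CommRing A] [Algebra ℂ A] [AddCommGroup V] [Module ℂ V]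
  (T : Module.End ℂ V) (f : A →ₗ[ℂ] V)

theorem polyLift_monomial (n : ℕ) (a : A) : polyLift T f (monomial n a) = (T ^ n) (f a) := by
  rw [polyLift, lsum_apply, sum_monomial_index _ _ (by simp)]
  rfl

theorem polyLift_C (a : A) : polyLift T f (C a) = f a := by
  rw [← monomial_zero_left, polyLift_monomial, pow_zero, Module.End.one_apply]

theorem polyLift_X_mul (u : A[X]) : polyLift T f (X * u) = T (polyLift T f u) := by
  induction u using Polynomial.induction_on' with
  | add u v hu hv => rw [mul_add, map_add, hu, hv, map_add, map_add]
  | monomial n a =>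
    rw [X_mul_monomial, polyLift_monomial, polyLift_monomial, pow_succ', Module.End.mul_apply]

end polyLift

namespace DualPair

open PolyModel

variable {φ : heisenberg →ₗ⁅ℂ⁆ ℂ} (D : DualPair φ)

/-- The polynomial ring `ℂ[t][h][e]` as a quasi-Whittaker module of type `φ`: the representation
`PolyModel.rep` composed with the twist. -/
abbrev Model : Type := RepSpace (rep.comp D.twist)

theorem ι_smul_model (x : Schrodinger) (u : D.Model) :
    UniversalEnvelopingAlgebra.ι ℂ x • u = rep (D.twist x) u :=
  repSpace_ι_smul _ x u

section

variable {V : Type*} [AddCommGroup V] [Module ℂ V] [Module USch V] [IsScalarTower ℂ USch V]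

/-- The linear map sending `e ^ i h ^ j t ^ k` to the ordered product of powers of the preimages
of `e`, `h`, `f` under the twist, applied to `v`. -/
def fromModel (v : V) : PolyModel →ₗ[ℂ] V :=
  polyLift (Algebra.lsmul ℂ ℂ V (UniversalEnvelopingAlgebra.ι ℂ D.preE)) <|
    polyLift (Algebra.lsmul ℂ ℂ V (UniversalEnvelopingAlgebra.ι ℂ D.preH)) <|
      polyLift (Algebra.lsmul ℂ ℂ V (UniversalEnvelopingAlgebra.ι ℂ D.preF)) <|
        LinearMap.toSpanSingleton ℂ V v

variable (v : V)

theorem fromModel_X_mul (u : PolyModel) :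
    D.fromModel v (X * u) = UniversalEnvelopingAlgebra.ι ℂ D.preE • D.fromModel v u :=
  polyLift_X_mul _ _ _

theorem fromModel_C_X_mul (g : ℂ[X][X]) :
    D.fromModel v (C (X * g)) = UniversalEnvelopingAlgebra.ι ℂ D.preH • D.fromModel v (C g) := by
  rw [fromModel, polyLift_C, polyLift_C, polyLift_X_mul]
  rfl

theorem fromModel_C_C_X_mul (d : ℂ[X]) :
    D.fromModel v (C (C (X * d))) =
      UniversalEnvelopingAlgebra.ι ℂ D.preF • D.fromModel v (C (C d)) := by
  rw [fromModel, polyLift_C, polyLift_C, polyLift_C, polyLift_C, polyLift_X_mul]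
  rfl

theorem fromModel_C_C_C (c : ℂ) : D.fromModel v (C (C (C c))) = c • v := by
  rw [fromModel, polyLift_C, polyLift_C, polyLift_C]
  rfl

theorem fromModel_one : D.fromModel v 1 = v := by
  have := D.fromModel_C_C_C v 1
  rwa [C_1, C_1, C_1, one_smul] at this

variable {v}

/-- The vectors `d(C) v` are transformed by the Heisenberg subalgebra through `φ`. -/
theorem heisenberg_smul_fromModel_C_C
    (hv : ∀ x : heisenberg, UniversalEnvelopingAlgebra.ι ℂ (x : Schrodinger) • v = φ x • v)
    (d : ℂ[X]) (x : heisenberg) :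
    UniversalEnvelopingAlgebra.ι ℂ (x : Schrodinger) • D.fromModel v (C (C d)) =
      φ x • D.fromModel v (C (C d)) := by
  revert x
  induction d using polynomial_induction_X_mul with
  | hC c =>
    intro x
    rw [fromModel_C_C_C, smul_comm, hv, smul_comm]
  | hadd f g hf hg =>
    intro x
    rw [C_add, C_add, map_add, smul_add, smul_add, hf, hg]
  | hX f hf =>
    intro x
    obtain ⟨y, hy, hy0⟩ := D.lie_preF_mem x
    rw [fromModel_C_C_X_mul, ι_smul_ι_smul, ← hy, hf, hf, hy0, zero_smul, add_zero, smul_comm]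

theorem fromModel_rep_C
    (hv : ∀ x : heisenberg, UniversalEnvelopingAlgebra.ι ℂ (x : Schrodinger) • v = φ x • v)
    (g : ℂ[X][X]) (x : Schrodinger) (hx : (D.twist x).e = 0) :
    D.fromModel v (rep (D.twist x) (C g)) =
      UniversalEnvelopingAlgebra.ι ℂ x • D.fromModel v (C g) := by
  revert x
  induction g using polynomial_induction_X_mul with
  | hC d =>
    intro x hx
    let y : heisenberg := ⟨⟨0, 0, 0, x.p, x.q, x.z⟩, mem_heisenberg.2 ⟨rfl, rfl, rfl⟩⟩
    have hxy : x = (D.twist x).h • D.preH + (D.twist x).f • D.preF + y := by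
      conv_lhs => rw [D.eq_pre_add x]
      rw [hx, zero_smul, zero_add]
    have hy : φ y = (D.twist x).p := by
      rw [character_apply, twist_p]
    conv_rhs => rw [hxy]
    rw [rep_C_C hx, map_add, map_add, map_smul, map_smul, map_smul, map_add, map_add, map_smul,
      map_smul, add_smul, add_smul, D.heisenberg_smul_fromModel_C_C hv, hy, fromModel_C_X_mul,
      fromModel_C_C_X_mul, smul_assoc, smul_assoc]
  | hadd f g hf hg =>
    intro x hx
    rw [C_add, map_add, map_add, map_add, smul_add, hf x hx, hg x hx]
  | hX g hg =>
    intro x hx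
    obtain ⟨g', hg'⟩ := exists_rep_C hx g
    have hxH : (D.twist ⁅x, D.preH⁆).e = 0 := by
      rw [LieHom.map_lie, twist_preH, lie_e, hx]
      simp [H]
    have h1 := hg x hx
    rw [hg'] at h1
    have h2 := hg _ hxH
    rw [LieHom.map_lie, twist_preH] at h2
    rw [← opH_C, ← rep_H, rep_rep, hg', rep_H, rep_H, opH_C, opH_C, map_add, fromModel_C_X_mul,
      fromModel_C_X_mul, ι_smul_ι_smul, h1, h2]

/-- The map from the model intertwines the actions. This holds on polynomials in `t` for
the Heisenberg subalgebra, hence on polynomials in `h, t` for the elements whose twist has no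
`e`-component, hence on all polynomials for all elements: each of these sets of elements is stable
under bracketing with the preimage of the variable added at that stage. -/
theorem fromModel_rep
    (hv : ∀ x : heisenberg, UniversalEnvelopingAlgebra.ι ℂ (x : Schrodinger) • v = φ x • v)
    (u : PolyModel) (x : Schrodinger) :
    D.fromModel v (rep (D.twist x) u) = UniversalEnvelopingAlgebra.ι ℂ x • D.fromModel v u := by
  revert x
  induction u using polynomial_induction_X_mul with
  | hC g =>
    intro x
    have hx0 : (D.twist (x - (D.twist x).e • D.preE)).e = 0 := by
      rw [map_sub, map_smul, twist_preE, sub_eq_add_neg]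
      simp [E]
    have h := D.fromModel_rep_C hv g _ hx0
    rw [map_sub, map_smul, twist_preE, map_sub, map_smul, LinearMap.sub_apply,
      LinearMap.smul_apply, rep_E, map_sub, map_smul, fromModel_X_mul, map_sub, map_smul,
      sub_smul, smul_assoc, sub_left_inj] at h
    exact h
  | hadd f g hf hg =>
    intro x
    rw [map_add, map_add, map_add, smul_add, hf x, hg x]
  | hX u hu =>
    intro x
    have h2 := hu ⁅x, D.preE⁆
    rw [LieHom.map_lie, twist_preE] at h2
    rw [← rep_E, rep_rep, rep_E, rep_E, map_add, fromModel_X_mul, fromModel_X_mul, ι_smul_ι_smul,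
      hu, h2]

end

/-- The vector `d(t)` of the model. -/
def const (d : ℂ[X]) : D.Model := (C (C d) : PolyModel)

theorem ι_smul_const (d : ℂ[X]) (x : heisenberg) :
    UniversalEnvelopingAlgebra.ι ℂ (x : Schrodinger) • D.const d = φ x • D.const d := by
  obtain ⟨he, hh, hf, hp⟩ := D.twist_heisenberg x
  rw [ι_smul_model, const, rep_C_C he, hh, hf, hp, zero_smul, zero_smul, zero_add, zero_add]
  rfl

theorem aeval_elemC_smul_const (d d' : ℂ[X]) :
    aeval (elemC φ) d • D.const d' = D.const (d * d') := by
  induction d using polynomial_induction_X_mul with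
  | hC c =>
    rw [aeval_C, algebraMap_smul]
    change c • (C (C d') : PolyModel) = C (C (C c * d'))
    rw [smul_C, smul_C, smul_eq_C_mul]
  | hadd f g hf hg =>
    rw [map_add, add_smul, hf, hg, add_mul]
    change C (C _) + C (C _) = C (C _)
    rw [C_add, C_add]
    rfl
  | hX f hf =>
    rw [map_mul, aeval_X, mul_smul, hf, D.elemC_eq, ι_smul_model, twist_preF, const, rep_F, opF_C,
      taylor_C, ← C_mul, mul_assoc]
    rfl

section Submodule

variable {D} (W : Submodule USch D.Model)

theorem rep_mem {x : Schrodinger} {u : D.Model} (hu : u ∈ W) :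
    (rep (D.twist x) u : D.Model) ∈ W := by
  rw [← ι_smul_model]
  exact W.smul_mem _ hu

theorem X_mul_mem {u : PolyModel} (hu : (u : D.Model) ∈ W) :
    ((X * u : PolyModel) : D.Model) ∈ W := by
  have := rep_mem W (x := D.preE) hu
  rwa [twist_preE, rep_E] at this

theorem opH_mem {u : PolyModel} (hu : (u : D.Model) ∈ W) :
    ((opH u : PolyModel) : D.Model) ∈ W := by
  have := rep_mem W (x := D.preH) hu
  rwa [twist_preH, rep_H] at this

theorem opP_mem {u : PolyModel} (hu : (u : D.Model) ∈ W) :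
    ((opP u : PolyModel) : D.Model) ∈ W := by
  have := rep_mem W (x := D.preP) hu
  rwa [twist_preP, rep_P] at this

theorem opQ_mem {u : PolyModel} (hu : (u : D.Model) ∈ W) :
    ((opQ u : PolyModel) : D.Model) ∈ W := by
  have := rep_mem W (x := D.preQ) hu
  rwa [twist_preQ, rep_Q] at this

theorem monomial_mem {d : ℂ[X]} (hd : D.const d ∈ W) (n m : ℕ) :
    ((monomial n (monomial m d) : PolyModel) : D.Model) ∈ W := by
  induction n with
  | zero =>
    rw [monomial_zero_left]
    induction m with
    | zero => rwa [monomial_zero_left]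
    | succ m hm =>
      rw [← X_mul_monomial, ← opH_C]
      exact opH_mem W hm
  | succ n hn =>
    rw [← X_mul_monomial]
    exact X_mul_mem W hn

theorem mul_const_mem {d : ℂ[X]} (hd : D.const d ∈ W) (r : ℂ[X]) : D.const (r * d) ∈ W := by
  rw [← aeval_elemC_smul_const]
  exact W.smul_mem _ hd

end Submodule

theorem span_const_one : Submodule.span USch {D.const 1} = ⊤ := by
  rw [eq_top_iff]
  rintro u -
  have h1 : D.const 1 ∈ Submodule.span USch {D.const 1} := Submodule.mem_span_singleton_self _
  generalize Submodule.span USch {D.const 1} = W at h1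
  change PolyModel at u
  induction u using Polynomial.induction_on' with
  | add u v hu hv => exact W.add_mem hu hv
  | monomial n g =>
    induction g using Polynomial.induction_on' with
    | add g g' hg hg' =>
      rw [map_add]
      exact W.add_mem hg hg'
    | monomial m d =>
      refine monomial_mem W ?_ n m
      rw [← mul_one d]
      exact mul_const_mem W h1 d

/-- The isomorphism of the universal quasi-Whittaker module with the polynomial model. -/
theorem exists_equiv_model :
    ∃ T : UniversalQW φ ≃ₗ[USch] D.Model, T (UniversalQW.gen φ) = D.const 1 := by
  obtain ⟨T, hT⟩ := UniversalQW.exists_lift (D.const 1) (D.ι_smul_const 1)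
  let S : D.Model →ₗ[USch] UniversalQW φ :=
    linearMapOfLie (V := D.Model) (D.fromModel (UniversalQW.gen φ)) fun x u => by
      rw [ι_smul_model]
      exact D.fromModel_rep (UniversalQW.ι_smul_gen φ) u x
  have hST : S ∘ₗ T = LinearMap.id := by
    refine LinearMap.ext_on (UniversalQW.span_gen φ) ?_
    rintro _ rfl
    rw [LinearMap.comp_apply, hT, LinearMap.id_apply]
    change D.fromModel _ (C (C 1)) = _
    rw [C_1, C_1, fromModel_one]
  have hTS : T ∘ₗ S = LinearMap.id := by
    refine LinearMap.ext_on D.span_const_one ?_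
    rintro _ rfl
    have h := LinearMap.congr_fun hST (UniversalQW.gen φ)
    rw [LinearMap.comp_apply, hT, LinearMap.id_apply] at h
    rw [LinearMap.comp_apply, h, hT, LinearMap.id_apply]
  exact ⟨LinearEquiv.ofLinearMap T S hTS hST, hT⟩

end DualPair

/-! ### Submodules of the model -/

section taylor

variable {R : Type*} [CommRing R]

theorem coeff_taylor_of_natDegree_le (r : R) {g : R[X]} {m : ℕ} (hg : g.natDegree ≤ m) :
    (taylor r g).coeff m = g.coeff m := by
  rcases hg.lt_or_eq with h | h
  · rw [coeff_eq_zero_of_natDegree_lt h, coeff_eq_zero_of_natDegree_lt]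
    rwa [natDegree_taylor]
  · rw [← h, coeff_taylor_natDegree, leadingCoeff]

theorem natDegree_taylor_sub_le (r : R) {g : R[X]} {m : ℕ} (hg : g.natDegree ≤ m + 1) :
    (taylor r g - g).natDegree ≤ m := by
  rw [natDegree_le_iff_coeff_eq_zero]
  intro k hk
  rw [coeff_sub, coeff_taylor_of_natDegree_le r (by omega), sub_self]

theorem coeff_taylor_sub (r : R) {g : R[X]} {m : ℕ} (hg : g.natDegree ≤ m + 1) :
    (taylor r g - g).coeff m = r * ((m + 1 : ℕ) * g.coeff (m + 1)) := by
  have h : (hasseDeriv m g).natDegree < 2 := by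
    have := natDegree_hasseDeriv_le g m
    omega
  rw [coeff_sub, taylor_coeff, eval_eq_sum_range' h, Finset.sum_range_succ, Finset.sum_range_one,
    hasseDeriv_coeff, hasseDeriv_coeff, zero_add, Nat.choose_self, add_comm 1 m,
    Nat.choose_succ_self_right]
  ring

end taylor

namespace DualPair

open PolyModel

variable {φ : heisenberg →ₗ⁅ℂ⁆ ℂ} {D : DualPair φ} (W : Submodule USch D.Model)

theorem const_mem_of_smul_mem {c : ℂ} (hc : c ≠ 0) {d : ℂ[X]} (h : D.const (c • d) ∈ W) :
    D.const d ∈ W := by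
  have := mul_const_mem W h (C c⁻¹)
  rwa [← smul_eq_C_mul, smul_smul, inv_mul_cancel₀ hc, one_smul] at this

/-- The difference operator `p - 1` lowers the degree in `h`, so that its powers isolate the top
coefficient. -/
theorem const_coeff_mem (m : ℕ) (g : ℂ[X][X]) (hg : g.natDegree ≤ m)
    (h : ((C g : PolyModel) : D.Model) ∈ W) : D.const (g.coeff m) ∈ W := by
  induction m generalizing g with
  | zero =>
    rw [eq_C_of_natDegree_le_zero hg] at h
    exact h
  | succ m hm =>
    have h1 : ((C (taylor (-1) g - g) : PolyModel) : D.Model) ∈ W := by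
      rw [C_sub, ← opP_C]
      exact W.sub_mem (opP_mem W h) h
    have h2 := hm _ (natDegree_taylor_sub_le _ hg) h1
    rw [coeff_taylor_sub _ hg] at h2
    refine const_mem_of_smul_mem W (c := -((m + 1 : ℕ) : ℂ)) ?_ ?_
    · exact neg_ne_zero.2 (Nat.cast_ne_zero.2 (Nat.succ_ne_zero m))
    · convert h2 using 2
      rw [smul_eq_C_mul, C_neg, C_eq_natCast]
      ring

/-- The operator `q` lowers the degree in `e`, which isolates the top coefficient. -/
theorem const_coeff_coeff_mem (n m : ℕ) (u : PolyModel) (hu : u.natDegree ≤ n)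
    (hm : (u.coeff n).natDegree ≤ m) (h : (u : D.Model) ∈ W) :
    D.const ((u.coeff n).coeff m) ∈ W := by
  induction n generalizing u with
  | zero =>
    rw [eq_C_of_natDegree_le_zero hu] at h
    exact const_coeff_mem W m _ hm h
  | succ n hn =>
    have hc : (opQ u).coeff n = -((n + 1 : ℕ) • taylor (-1) (u.coeff (n + 1))) := by
      rw [opQ_apply, coeff_neg, coeff_derivative, coeff_shift]
      rw [nsmul_eq_mul]
      push_cast
      ring
    have hd : (opQ u).natDegree ≤ n := by
      rw [natDegree_le_iff_coeff_eq_zero] at hu ⊢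
      intro k hk
      rw [opQ_apply, coeff_neg, coeff_derivative, coeff_shift, hu (k + 1) (by omega), map_zero,
        zero_mul, neg_zero]
    have h2 := hn _ hd ?_ (opQ_mem W h)
    · rw [hc] at h2
      refine const_mem_of_smul_mem W (c := -((n + 1 : ℕ) : ℂ)) ?_ ?_
      · exact neg_ne_zero.2 (Nat.cast_ne_zero.2 (Nat.succ_ne_zero n))
      · convert h2 using 2
        rw [coeff_neg, coeff_smul, coeff_taylor_of_natDegree_le _ hm, neg_smul,
          Nat.cast_smul_eq_nsmul]
    · rw [hc, natDegree_neg]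
      refine (natDegree_smul_le _ _).trans ?_
      rwa [natDegree_taylor]

/-- A submodule of the model is determined by the polynomials in `t` that it contains. -/
theorem le_of_const_mem {W W' : Submodule USch D.Model}
    (h : ∀ d, D.const d ∈ W → D.const d ∈ W') : W ≤ W' := by
  have key : ∀ (n : ℕ) (u : PolyModel), u.degree < n → (u : D.Model) ∈ W → (u : D.Model) ∈ W' := by
    intro n
    induction n with
    | zero =>
      intro u hu _
      have : u = 0 := by
        rw [← degree_eq_bot]
        simpa using hu
      rw [this]
      exact W'.zero_mem
    | succ n hn =>
      intro u hu
      have hun : u.natDegree ≤ n := natDegree_le_iff_coeff_eq_zero.2 fun k hk =>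
        (degree_lt_iff_coeff_zero u (n + 1)).1 hu k hk
      obtain ⟨m, hm⟩ : ∃ m : ℕ, (u.coeff n).degree < m := 
        ⟨_, degree_le_natDegree.trans_lt (WithBot.coe_lt_coe.2 (Nat.lt_succ_self _))⟩
      induction m generalizing u with
      | zero =>
        have h0 : u.coeff n = 0 := by
          rw [← degree_eq_bot]
          simpa using hm
        refine hn u ((degree_lt_iff_coeff_zero u n).2 fun k hk => ?_)
        rcases hk.eq_or_lt with rfl | hk
        · exact h0
        · exact (degree_lt_iff_coeff_zero u (n + 1)).1 hu k hk
      | succ m ih =>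
        intro huW
        have hmn : (u.coeff n).natDegree ≤ m := natDegree_le_iff_coeff_eq_zero.2 fun k hk =>
          (degree_lt_iff_coeff_zero _ (m + 1)).1 hm k hk
        have hc := const_coeff_coeff_mem W n m u hun hmn huW
        have h1 := monomial_mem W hc n m
        have h2 := monomial_mem W' (h _ hc) n m
        have h3 := ih (u - monomial n (monomial m ((u.coeff n).coeff m))) ?_ ?_ ?_
          (W.sub_mem huW h1)
        · exact Eq.mp (congrArg (fun v : D.Model => v ∈ W') (sub_add_cancel u _))
            (W'.add_mem h3 h2)
        · refine (degree_lt_iff_coeff_zero _ (n + 1)).2 fun k hk => ?_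
          rw [coeff_sub, coeff_monomial, if_neg (by omega), sub_zero]
          exact (degree_lt_iff_coeff_zero u (n + 1)).1 hu k hk
        · refine natDegree_le_iff_coeff_eq_zero.2 fun k hk => ?_
          rw [coeff_sub, coeff_monomial, if_neg (by omega), sub_zero]
          exact natDegree_le_iff_coeff_eq_zero.1 hun k hk
        · refine (degree_lt_iff_coeff_zero _ m).2 fun k hk => ?_
          rw [coeff_sub, coeff_monomial, if_pos rfl, coeff_sub, coeff_monomial]
          rcases hk.eq_or_lt with rfl | hk
          · rw [if_pos rfl, sub_self]
          · rw [if_neg (by omega), sub_zero]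
            exact (degree_lt_iff_coeff_zero _ (m + 1)).1 hm k hk
  intro u hu
  exact key _ (u : PolyModel)
    (degree_le_natDegree.trans_lt (WithBot.coe_lt_coe.2 (Nat.lt_succ_self _))) hu

/-- Every submodule of the model is generated by a polynomial in `t`, because the polynomials in
`t` that it contains form an ideal of a principal ideal domain. -/
theorem exists_eq_span_const (W : Submodule USch D.Model) :
    ∃ d : ℂ[X], W = Submodule.span USch {D.const d} := by
  let I : Ideal ℂ[X] :=
    { carrier := {d | D.const d ∈ W}
      add_mem' := fun {a b} ha hb => by
        rw [Set.mem_ofPred_eq] at ha hb ⊢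
        convert W.add_mem ha hb using 1
        change C (C _) = C (C _) + C (C _)
        rw [C_add, C_add]
        rfl
      zero_mem' := by
        rw [Set.mem_ofPred_eq]
        convert W.zero_mem using 1
        change C (C _) = (0 : PolyModel)
        rw [C_0, C_0]
      smul_mem' := fun r d hd => mul_const_mem W hd r }
  have hI : ∀ d, d ∈ I ↔ D.const d ∈ W := fun d => Iff.rfl
  obtain ⟨d, hd⟩ := IsPrincipalIdealRing.principal I
  refine ⟨d, le_antisymm (le_of_const_mem fun c hc => ?_) ?_⟩
  · rw [← hI, hd, Submodule.mem_span_singleton] at hc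
    obtain ⟨r, rfl⟩ := hc
    exact mul_const_mem _ (Submodule.mem_span_singleton_self _) r
  · rw [Submodule.span_singleton_le_iff_mem, ← hI, hd]
    exact Submodule.mem_span_singleton_self _

/-- The polynomials in `t` commute with the action. -/
theorem rep_mul_C_C (d : ℂ[X]) (x : Schrodinger) (u : PolyModel) :
    rep x (C (C d) * u) = C (C d) * rep x u := by
  have hE : opE (C (C d) * u) = C (C d) * opE u := by
    rw [opE_apply, opE_apply]
    ring
  have hH : opH (C (C d) * u) = C (C d) * opH u := by
    rw [opH_apply, opH_apply, derivative_C_mul]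
    ring
  have hF : opF (C (C d) * u) = C (C d) * opF u := by
    rw [opF_apply, opF_apply, derivative_C_mul, derivative_C_mul, map_mul, shift_C, taylor_C]
    ring
  have hP : opP (C (C d) * u) = C (C d) * opP u := by
    rw [opP_apply, opP_apply, map_mul, shift_C, taylor_C]
  have hQ : opQ (C (C d) * u) = C (C d) * opQ u := by
    rw [opQ_apply, opQ_apply, map_mul, shift_C, taylor_C, derivative_C_mul, mul_neg]
  rw [rep_apply, rep_apply, hE, hH, hF, hP, hQ]
  simp only [mul_add, mul_smul_comm]

/-- Multiplication by a nonzero polynomial in `t` is an injective endomorphism of the model. -/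
theorem exists_injective_const {d : ℂ[X]} (hd : d ≠ 0) :
    ∃ T : D.Model →ₗ[USch] D.Model, Function.Injective T ∧ T (D.const 1) = D.const d := by
  refine ⟨linearMapOfLie (V := D.Model) (W := D.Model) (LinearMap.mulLeft ℂ (C (C d)))
    fun x u => ?_, ?_, ?_⟩
  · rw [ι_smul_model, ι_smul_model]
    exact (rep_mul_C_C d _ u).symm
  · have h : (C (C d) : PolyModel) ≠ 0 := C_ne_zero.2 (C_ne_zero.2 hd)
    exact mul_right_injective₀ h
  · change C (C d) * C (C 1) = (C (C d) : PolyModel)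
    rw [C_1, C_1, mul_one]

end DualPair

end

end Schrodinger

theorem theorem5p4 (φ : Schrodinger.heisenberg →ₗ⁅ℂ⁆ ℂ) (hφ : φ ≠ 0)
    (U : Submodule Schrodinger.USch (Schrodinger.UniversalQW φ)) (hU : U ≠ ⊥) :
    Nonempty (U ≃ₗ[Schrodinger.USch] Schrodinger.UniversalQW φ) ∧
    ∃ d : ℂ[X],
      Schrodinger.IsQuasiWhittakerVector φ
        (aeval (Schrodinger.elemC φ) d • Schrodinger.UniversalQW.gen φ) ∧
      U = Submodule.span Schrodinger.USch
        {aeval (Schrodinger.elemC φ) d • Schrodinger.UniversalQW.gen φ} := by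
  obtain ⟨D⟩ := Schrodinger.nonempty_dualPair hφ
  obtain ⟨T, hT⟩ := D.exists_equiv_model
  obtain ⟨d, hd⟩ := Schrodinger.DualPair.exists_eq_span_const (D := D) (U.map T.toLinearMap)
  have hTd : T (aeval (Schrodinger.elemC φ) d • Schrodinger.UniversalQW.gen φ) = D.const d := by
    rw [map_smul, hT, D.aeval_elemC_smul_const, mul_one]
  have hUd : U = Submodule.span Schrodinger.USch
      {aeval (Schrodinger.elemC φ) d • Schrodinger.UniversalQW.gen φ} := by
    apply Submodule.map_injective_of_injective (f := T.toLinearMap) T.injective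
    rw [hd, Submodule.map_span, Set.image_singleton]
    exact congrArg (fun v => Submodule.span Schrodinger.USch {v}) hTd.symm
  have hw0 : aeval (Schrodinger.elemC φ) d • Schrodinger.UniversalQW.gen φ ≠ 0 := by
    intro h
    rw [h, Submodule.span_zero_singleton] at hUd
    exact hU hUd
  have hd0 : d ≠ 0 := by
    rintro rfl
    rw [map_zero, zero_smul] at hw0
    exact hw0 rfl
  refine ⟨?_, d, ⟨hw0, fun x => ?_⟩, hUd⟩
  · obtain ⟨S, hS, hS1⟩ := Schrodinger.DualPair.exists_injective_const (D := D) hd0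
    -- The endomorphism of the universal module sending the generator `w` to `d(C) w`.
    let R := T.symm.toLinearMap ∘ₗ S ∘ₗ T.toLinearMap
    have hR : Function.Injective R := T.symm.injective.comp (hS.comp T.injective)
    have hRw : R (Schrodinger.UniversalQW.gen φ) =
        aeval (Schrodinger.elemC φ) d • Schrodinger.UniversalQW.gen φ := by
      change T.symm (S (T _)) = _
      rw [hT, hS1, ← hTd, T.symm_apply_apply]
    have hrange : LinearMap.range R = U := by
      rw [LinearMap.range_eq_map, ← Schrodinger.UniversalQW.span_gen, Submodule.map_span,
        Set.image_singleton, hRw, ← hUd]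
    exact ⟨((LinearEquiv.ofInjective R hR).trans (LinearEquiv.ofEq _ _ hrange)).symm⟩
  · apply T.injective
    rw [T.map_smul, T.map_smul (algebraMap ℂ _ (φ x)), hTd, D.ι_smul_const, algebraMap_smul]
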